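/- Let $V$ be a complex normed space. A semi-inner product on $V$ compatible with the norm is a map $[\cdot,\cdot]:V\times V\to\mathbb{C}$ that is linear in the first variable and satisfies $[v,v]=\|v\|^2$ and $|[v,w]|\le\|v\|\,\|w\|$ for all $v,w\in V$. A map $T:V\to V$ is called a hermitian operator if it is a bounded complex-linear operator and $[Tv,v]\in\mathbb{R}$ for every $v\in V$ and every compatible semi-inner product on $V$ (compatible semi-inner products exist, and the condition does not depend on which one is used). Let $X$ be a compact metric space with metric $d$ and let $E$ be a complex Banach space. Let $\mathrm{Lip}(X,E)$ be the complex vector space of all Lipschitz maps $F:X\to E$, with the norm $$\|F\|_L=\sup_{x\in X}\|F(x)\|_E+L(F),\qquad L(F)=\sup_{x\neq y}\frac{\|F(x)-F(y)\|_E}{d(x,y)},$$ where a supremum over the empty set is $0$. **Theorem.** A map $T:\mathrm{Lip}(X,E)\to\mathrm{Lip}(X,E)$ is a hermitian operator with respect to $\|\cdot\|_L$ if and only if there exists a hermitian operator $\phi:E\to E$ such that $$TF(x)=\phi(F(x))\qquad\text{for all }F\in\mathrm{Lip}(X,E)\text{ and }x\in X.$$ -/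

import Mathlib

open scoped NNReal

noncomputable section

/-! ### Lipschitz maps with the sum norm -/

/-- The Lipschitz maps `X → E`, as a complex subspace of the space of all maps. -/
def lipSubmodule (X E : Type*) [MetricSpace X] [NormedAddCommGroup E] [NormedSpace ℂ E] :
    Submodule ℂ (X → E) where
  carrier := {F | ∃ K : ℝ≥0, LipschitzWith K F}
  zero_mem' := ⟨0, LipschitzWith.const 0⟩
  add_mem' := by
    rintro F G ⟨K, hK⟩ ⟨K', hK'⟩
    exact ⟨K + K', hK.add hK'⟩
  smul_mem' := by
    rintro c F ⟨K, hK⟩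
    refine ⟨‖c‖₊ * K, LipschitzWith.of_dist_le_mul fun x y => ?_⟩
    have h := hK.dist_le_mul x y
    simp only [Pi.smul_apply, dist_smul₀, NNReal.coe_mul, coe_nnnorm, mul_assoc]
    exact mul_le_mul_of_nonneg_left h (norm_nonneg c)

/-- The space `Lip(X, E)` of all `E`-valued Lipschitz maps on `X`. -/
def Lip (X E : Type*) [MetricSpace X] [NormedAddCommGroup E] [NormedSpace ℂ E] :=
  ↥(lipSubmodule X E)

namespace Lip

variable {X E : Type*} [MetricSpace X] [NormedAddCommGroup E] [NormedSpace ℂ E]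

instance instAddCommGroup : AddCommGroup (Lip X E) :=
  inferInstanceAs (AddCommGroup ↥(lipSubmodule X E))

instance instModule : Module ℂ (Lip X E) :=
  inferInstanceAs (Module ℂ ↥(lipSubmodule X E))

instance instFunLike : FunLike (Lip X E) X E where
  coe F := F.1
  coe_injective := fun _ _ h => Subtype.ext h

@[ext] theorem ext {F G : Lip X E} (h : ∀ x, F x = G x) : F = G := DFunLike.ext F G h

@[simp] theorem zero_apply (x : X) : (0 : Lip X E) x = 0 := rfl
@[simp] theorem add_apply (F G : Lip X E) (x : X) : (F + G) x = F x + G x := rfl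
@[simp] theorem smul_apply (c : ℂ) (F : Lip X E) (x : X) : (c • F) x = c • F x := rfl

theorem lipschitz (F : Lip X E) : ∃ K : ℝ≥0, LipschitzWith K F := F.2

/-- The supremum norm `‖F‖_∞`. -/
def supNorm (F : Lip X E) : ℝ := ⨆ x : X, ‖F x‖

/-- The Lipschitz constant `L(F)`, the supremum of `‖F x - F y‖ / d(x, y)` over `x ≠ y`.
It is `0` when `X` has at most one point. -/
def lipConst (F : Lip X E) : ℝ :=
  ⨆ p : {p : X × X // p.1 ≠ p.2}, ‖F p.1.1 - F p.1.2‖ / dist p.1.1 p.1.2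

/-- The sum norm `‖F‖_L = ‖F‖_∞ + L(F)`. -/
instance instNorm : Norm (Lip X E) := ⟨fun F => F.supNorm + F.lipConst⟩

theorem norm_def (F : Lip X E) : ‖F‖ = F.supNorm + F.lipConst := rfl

theorem bddAbove_norm [CompactSpace X] (F : Lip X E) :
    BddAbove (Set.range fun x : X => ‖F x‖) := by
  obtain ⟨K, hK⟩ := F.lipschitz
  exact (isCompact_range hK.continuous.norm).bddAbove

theorem bddAbove_quotient (F : Lip X E) :
    BddAbove (Set.range fun p : {p : X × X // p.1 ≠ p.2} =>
      ‖F p.1.1 - F p.1.2‖ / dist p.1.1 p.1.2) := by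
  obtain ⟨K, hK⟩ := F.lipschitz
  refine ⟨K, ?_⟩
  rintro _ ⟨p, rfl⟩
  have h := hK.dist_le_mul p.1.1 p.1.2
  rw [dist_eq_norm] at h
  exact (div_le_iff₀ (dist_pos.2 p.2)).2 h

theorem supNorm_nonneg (F : Lip X E) : 0 ≤ F.supNorm :=
  Real.iSup_nonneg fun _ => norm_nonneg _

theorem lipConst_nonneg (F : Lip X E) : 0 ≤ F.lipConst :=
  Real.iSup_nonneg fun _ => div_nonneg (norm_nonneg _) dist_nonneg

theorem normCore [CompactSpace X] : NormedSpace.Core ℂ (Lip X E) where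
  norm_nonneg F := add_nonneg F.supNorm_nonneg F.lipConst_nonneg
  norm_smul c F := by
    simp only [norm_def, supNorm, lipConst, smul_apply, ← smul_sub, norm_smul, mul_div_assoc,
      mul_add, Real.mul_iSup_of_nonneg (norm_nonneg c)]
  norm_triangle F G := by
    have h1 : (F + G).supNorm ≤ F.supNorm + G.supNorm :=
      Real.iSup_le (fun x => (norm_add_le _ _).trans
        (add_le_add (le_ciSup F.bddAbove_norm x) (le_ciSup G.bddAbove_norm x)))
        (add_nonneg F.supNorm_nonneg G.supNorm_nonneg)
    have h2 : (F + G).lipConst ≤ F.lipConst + G.lipConst := by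
      refine Real.iSup_le (fun p => ?_) (add_nonneg F.lipConst_nonneg G.lipConst_nonneg)
      refine le_trans ?_
        (add_le_add (le_ciSup F.bddAbove_quotient p) (le_ciSup G.bddAbove_quotient p))
      rw [← add_div, add_apply, add_apply, add_sub_add_comm]
      exact div_le_div_of_nonneg_right (norm_add_le _ _) dist_nonneg
    simp only [norm_def]
    linarith
  norm_eq_zero_iff F := by
    constructor
    · intro h
      have h0 : F.supNorm = 0 := by
        have := F.supNorm_nonneg
        have := F.lipConst_nonneg
        rw [norm_def] at h
        linarith
      ext x
      exact norm_le_zero_iff.1 (h0 ▸ le_ciSup F.bddAbove_norm x)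
    · rintro rfl
      simp [norm_def, supNorm, lipConst]

instance instNormedAddCommGroup [CompactSpace X] : NormedAddCommGroup (Lip X E) :=
  NormedAddCommGroup.ofCore normCore

instance instNormedSpace [CompactSpace X] : NormedSpace ℂ (Lip X E) :=
  NormedSpace.ofCore normCore

end Lip

/-! ### Hermitian operators -/

/-- A semi-inner product (in the sense of Lumer) on a complex normed space `V` that is compatible
with the norm: linear in the first variable, `[v, v] = ‖v‖ ^ 2` (so `[v, v] > 0` for `v ≠ 0`), and
`|[v, w]| ^ 2 ≤ [v, v] [w, w]`, that is, `|[v, w]| ≤ ‖v‖ ‖w‖`. -/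
structure SemiInnerProduct (V : Type*) [NormedAddCommGroup V] [NormedSpace ℂ V] where
  toFun : V → V → ℂ
  add_left : ∀ u v w, toFun (u + v) w = toFun u w + toFun v w
  smul_left : ∀ (c : ℂ) (v w : V), toFun (c • v) w = c * toFun v w
  self_eq : ∀ v, toFun v v = ((‖v‖ ^ 2 : ℝ) : ℂ)
  norm_le : ∀ v w, ‖toFun v w‖ ≤ ‖v‖ * ‖w‖

/-- By the Hahn-Banach theorem every complex normed space has a compatible semi-inner product. -/
theorem SemiInnerProduct.nonempty (V : Type*) [NormedAddCommGroup V] [NormedSpace ℂ V] :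
    Nonempty (SemiInnerProduct V) := by
  choose g hg1 hg2 using fun w : V => exists_dual_vector'' ℂ w
  refine ⟨⟨fun v w => ‖w‖ * g w v, ?_, ?_, ?_, ?_⟩⟩
  · intro u v w
    simp [mul_add]
  · intro c v w
    simp only [map_smul, smul_eq_mul]
    ring
  · intro v
    simp only [hg2]
    push_cast
    simp [sq]
  · intro v w
    have h := (g w).le_of_opNorm_le (hg1 w) v
    rw [norm_mul, Complex.norm_real, norm_norm, mul_comm]
    exact mul_le_mul_of_nonneg_right (by simpa using h) (norm_nonneg w)

/-- A map `T : V → V` on a complex normed space is a hermitian operator if it is a bounded linear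
operator and `[T v, v]` is real for all `v`, for the semi-inner products compatible with the norm
(at least one exists, and the condition does not depend on which one is used). -/
def IsHermitianOperator {V : Type*} [NormedAddCommGroup V] [NormedSpace ℂ V] (T : V → V) : Prop :=
  IsBoundedLinearMap ℂ T ∧ ∀ (s : SemiInnerProduct V) (v : V), (s.toFun (T v) v).im = 0

end

/-! The hermitian condition says that `f (T v)` is real for every support functional `f` at `v`, that
is, every linear `f` with `|f w| ≤ ‖w‖` and `f v = ‖v‖` (`IsHermitianOperator.im_eq_zero`,
`IsHermitianOperator.of_im_eq_zero`).

If `φ` is hermitian on `E`, then `1 + i s φ` has norm at most `1 + s² ‖φ‖²` by Lumer's argument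
(`IsHermitianOperator.norm_add_smul_le`). Composition with an operator of norm `C` has norm at most
`C` on `Lip(X, E)`, so `F ↦ φ ∘ F` satisfies the same estimate, and this estimate makes it hermitian
(`IsHermitianOperator.of_norm_add_smul_le`).

Conversely, let `T` be hermitian on `Lip(X, E)`. A functional `F ↦ e (F x₀) + ψ F`, where `e`
supports `F x₀`, `‖F x₀‖` is the supremum norm of `F` and `ψ` supports the Lipschitz constant at `F`,
supports the sum norm at `F`. When `F` is constant, `ψ` may be any functional dominated by the
Lipschitz constant, and it follows that `T` maps constants to constants (`Lip.apply_const_eq`). The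
operator `φ` that `T` induces on constants is hermitian, and after subtracting `F ↦ φ ∘ F` it remains
to see that `T = 0` when `T` annihilates the constants (`Lip.apply_eq_zero_of_const`).

For this let `F x₀ = 0`, let `e` support the unit vector `v`, and put `G = F - M d(·, x₀) v` with `M`
large. Adding the constant `λ ω v`, with `λ` large and `ω` in an arc of the unit circle around `1`,
changes neither `T G` nor the support functionals `ψ` of the Lipschitz constant at `G`, and it moves
the maximum of the norm to `x₀`. Hence `Im (conj ω * e (T G x₀)) + Im (ψ (T G)) = 0` for one `ψ` and
all these `ω` (`Lip.im_conj_mul_add_eq_zero`), which forces `e (T G x₀) = 0`. As this expression is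
affine in `M`, also `e (T F x₀) = 0`; for `v` in the direction of `T F x₀` this says `T F x₀ = 0`. -/

open scoped ComplexConjugate

/-- Hahn–Banach: every complex seminorm has a support functional at every vector. -/
theorem Seminorm.exists_support {V : Type*} [AddCommGroup V] [Module ℂ V] (p : Seminorm ℂ V)
    (v : V) : ∃ f : V →ₗ[ℂ] ℂ, (∀ w, ‖f w‖ ≤ p w) ∧ f v = (p v : ℂ) := by
  let _ : SeminormedAddCommGroup V := p.toAddGroupSeminorm.toSeminormedAddCommGroup
  let _ : NormedSpace ℂ V := ⟨fun c w => (map_smul_eq_mul p c w).le⟩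
  obtain ⟨g, hg, hgv⟩ := exists_dual_vector'' ℂ v
  exact ⟨g.toLinearMap, fun w => (g.le_of_opNorm_le hg w).trans_eq (one_mul _), hgv⟩

/-! ### Hermitian operators and support functionals -/

section Hermitian

variable {V : Type*} [NormedAddCommGroup V] [NormedSpace ℂ V]

theorem exists_support_functional (v : V) :
    ∃ f : V →ₗ[ℂ] ℂ, (∀ w, ‖f w‖ ≤ ‖w‖) ∧ f v = (‖v‖ : ℂ) :=
  (normSeminorm ℂ V).exists_support v

/-- Every support functional at `v` is, up to the factor `‖v‖`, the value at `v` of some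
compatible semi-inner product; hence a hermitian operator is tested by all of them. -/
theorem IsHermitianOperator.im_eq_zero {T : V → V} (hT : IsHermitianOperator T)
    {f : V →ₗ[ℂ] ℂ} (hf : ∀ w, ‖f w‖ ≤ ‖w‖) {v : V} (hv : f v = (‖v‖ : ℂ)) :
    (f (T v)).im = 0 := by
  have key : ∀ w : V, ∃ g : V →ₗ[ℂ] ℂ,
      (∀ u, ‖g u‖ ≤ ‖u‖) ∧ g w = (‖w‖ : ℂ) ∧ (w = v → g = f) := by
    intro w
    by_cases h : w = v
    · exact ⟨f, hf, h ▸ hv, fun _ => rfl⟩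
    · obtain ⟨g, hg, hgw⟩ := exists_support_functional w
      exact ⟨g, hg, hgw, fun h' => absurd h' h⟩
  choose g hg hgw hgv using key
  let s : SemiInnerProduct V :=
    { toFun := fun u w => ‖w‖ * g w u
      add_left := fun u u' w => by rw [map_add, mul_add]
      smul_left := fun c u w => by rw [map_smul, smul_eq_mul]; ring
      self_eq := fun w => by rw [hgw]; push_cast; ring
      norm_le := fun u w => by
        rw [norm_mul, Complex.norm_real, norm_norm, mul_comm]
        exact mul_le_mul_of_nonneg_right (hg w u) (norm_nonneg w) }
  have h : ((‖v‖ : ℂ) * g v (T v)).im = 0 := hT.2 s v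
  rw [hgv v rfl, Complex.im_ofReal_mul] at h
  rcases mul_eq_zero.1 h with h0 | h0
  · rw [norm_eq_zero.1 h0, hT.1.toIsLinearMap.map_zero, map_zero, Complex.zero_im]
  · exact h0

theorem IsHermitianOperator.of_im_eq_zero {T : V → V} (hT : IsBoundedLinearMap ℂ T)
    (h : ∀ (f : V →ₗ[ℂ] ℂ) (v : V), (∀ w, ‖f w‖ ≤ ‖w‖) → f v = (‖v‖ : ℂ) → (f (T v)).im = 0) :
    IsHermitianOperator T := by
  refine ⟨hT, fun s v => ?_⟩
  rcases eq_or_ne v 0 with rfl | hv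
  · have := s.norm_le (T 0) 0
    rw [norm_zero, mul_zero, norm_le_zero_iff] at this
    rw [this, Complex.zero_im]
  have hv' : ‖v‖ ≠ 0 := norm_ne_zero_iff.2 hv
  let f : V →ₗ[ℂ] ℂ :=
    { toFun := fun u => ((‖v‖⁻¹ : ℝ) : ℂ) * s.toFun u v
      map_add' := fun u u' => by rw [s.add_left, mul_add]
      map_smul' := fun c u => by rw [s.smul_left, RingHom.id_apply, smul_eq_mul]; ring }
  have hf := h f v (fun w => ?_) ?_
  · change (((‖v‖⁻¹ : ℝ) : ℂ) * s.toFun (T v) v).im = 0 at hf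
    rw [Complex.im_ofReal_mul] at hf
    exact (mul_eq_zero.1 hf).resolve_left (inv_ne_zero hv')
  · change ‖((‖v‖⁻¹ : ℝ) : ℂ) * s.toFun w v‖ ≤ ‖w‖
    rw [norm_mul, Complex.norm_real, norm_inv, norm_norm, inv_mul_le_iff₀ (norm_pos_iff.2 hv),
      mul_comm ‖v‖]
    exact s.norm_le w v
  · change ((‖v‖⁻¹ : ℝ) : ℂ) * s.toFun v v = ‖v‖
    rw [s.self_eq, ← Complex.ofReal_mul, pow_two, inv_mul_cancel_left₀ hv']

theorem IsHermitianOperator.sub {T S : V → V} (hT : IsHermitianOperator T)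
    (hS : IsHermitianOperator S) : IsHermitianOperator fun v => T v - S v :=
  .of_im_eq_zero (hT.1.sub hS.1) fun f v hf hv => by
    rw [map_sub, Complex.sub_im, hT.im_eq_zero hf hv, hS.im_eq_zero hf hv, sub_zero]

/-- A support functional at `w` has real part at least `‖w‖` at `w - i s A w`, so `1 - i s A` does
not shrink norms. Applying this to `w = (1 + i s A) v` gives the bound, as
`(1 - i s A) (1 + i s A) = 1 + s² A²`. -/
theorem IsHermitianOperator.norm_add_smul_le {A : V →L[ℂ] V} (hA : IsHermitianOperator A)
    (s : ℝ) (v : V) : ‖v + ((s : ℂ) * Complex.I) • A v‖ ≤ (1 + s ^ 2 * ‖A‖ ^ 2) * ‖v‖ := by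
  have key : ∀ w : V, ‖w‖ ≤ ‖w - ((s : ℂ) * Complex.I) • A w‖ := by
    intro w
    obtain ⟨f, hf, hfw⟩ := exists_support_functional w
    have him := hA.im_eq_zero hf hfw
    refine le_trans ?_ (hf _)
    refine le_trans (le_of_eq ?_) (Complex.re_le_norm _)
    rw [map_sub, map_smul, hfw]
    simp [him]
  refine (key _).trans ?_
  have h : v + ((s : ℂ) * Complex.I) • A v
      - ((s : ℂ) * Complex.I) • A (v + ((s : ℂ) * Complex.I) • A v)
      = v + ((s ^ 2 : ℝ) : ℂ) • A (A v) := by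
    rw [map_add, map_smul, smul_add, smul_smul]
    have : (s : ℂ) * Complex.I * (s * Complex.I) = -((s ^ 2 : ℝ) : ℂ) := by
      push_cast
      linear_combination (s : ℂ) ^ 2 * Complex.I_mul_I
    rw [this, neg_smul]
    abel
  rw [h]
  refine (norm_add_le _ _).trans ?_
  rw [norm_smul, Complex.norm_real, Real.norm_of_nonneg (sq_nonneg s)]
  have h1 : ‖A (A v)‖ ≤ ‖A‖ * (‖A‖ * ‖v‖) :=
    (A.le_opNorm _).trans (mul_le_mul_of_nonneg_left (A.le_opNorm v) (norm_nonneg _))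
  nlinarith [mul_le_mul_of_nonneg_left h1 (sq_nonneg s)]

/-- A converse of `IsHermitianOperator.norm_add_smul_le`: it suffices that the norm of `1 + i s A`
exceeds `1` by at most a multiple of `s²`. -/
theorem IsHermitianOperator.of_norm_add_smul_le {A : V → V} (hA : IsBoundedLinearMap ℂ A) (C : ℝ)
    (h : ∀ (s : ℝ) (v : V), ‖v + ((s : ℂ) * Complex.I) • A v‖ ≤ (1 + s ^ 2 * C) * ‖v‖) :
    IsHermitianOperator A := by
  refine .of_im_eq_zero hA fun f v hf hv => ?_
  set a := (f (A v)).im with ha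
  have key : ∀ s : ℝ, -(s * a) ≤ s ^ 2 * (C * ‖v‖) := by
    intro s
    have h1 := (Complex.re_le_norm _).trans ((hf _).trans (h s v))
    rw [map_add, map_smul, hv] at h1
    simp only [Complex.add_re, Complex.ofReal_re, smul_eq_mul, Complex.mul_re, Complex.mul_im,
      Complex.I_re, Complex.I_im, Complex.ofReal_im, ← ha] at h1
    linarith
  by_contra hne
  set K := |C * ‖v‖| + 1 with hK
  have hKpos : 0 < K := by positivity
  -- At `s = -a / K` the linear term `a² / K` exceeds the quadratic one.
  have h1 := key (-(a / K))
  have h2 : (-(a / K)) ^ 2 * (C * ‖v‖) < (-(a / K)) ^ 2 * K := by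
    have hne' : -(a / K) ≠ 0 := neg_ne_zero.2 (div_ne_zero hne hKpos.ne')
    refine mul_lt_mul_of_pos_left ?_ (by positivity)
    linarith [le_abs_self (C * ‖v‖)]
  have h3 : (-(a / K)) ^ 2 * K = -(-(a / K) * a) := by field_simp
  linarith

end Hermitian

/-! ### The space of Lipschitz maps -/

namespace Lip

variable {X E : Type*} [MetricSpace X] [NormedAddCommGroup E] [NormedSpace ℂ E]

@[simp] theorem sub_apply (F G : Lip X E) (x : X) : (F - G) x = F x - G x := rfl

/-- The constant map with value `e`. -/
def const (X : Type*) [MetricSpace X] (e : E) : Lip X E :=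
  ⟨fun _ => e, 0, LipschitzWith.const e⟩

@[simp] theorem const_apply (e : E) (x : X) : const X e x = e := rfl

theorem const_add (e e' : E) : const X (e + e') = const X e + const X e' := rfl

theorem const_smul (c : ℂ) (e : E) : const X (c • e) = c • const X e := rfl

@[simp] theorem lipConst_const (e : E) : (const X e).lipConst = 0 := by simp [lipConst]

theorem norm_const [Nonempty X] (e : E) : ‖const X e‖ = ‖e‖ := by
  rw [norm_def, lipConst_const, add_zero]
  exact ciSup_const (ι := X) (a := ‖e‖)

@[simp] theorem lipConst_add_const (F : Lip X E) (e : E) :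
    (F + const X e).lipConst = F.lipConst := by simp [lipConst]

/-- The composition of a Lipschitz map with a bounded linear operator. -/
def postcomp (A : E →L[ℂ] E) (F : Lip X E) : Lip X E :=
  ⟨fun x => A (F x), F.lipschitz.elim fun _ hK => ⟨_, A.lipschitz.comp hK⟩⟩

@[simp] theorem postcomp_apply (A : E →L[ℂ] E) (F : Lip X E) (x : X) :
    postcomp A F x = A (F x) := rfl

/-- The scalar map `d(·, x₀)` times the vector `v`. -/
noncomputable def distSMul (x₀ : X) (v : E) : Lip X E :=
  ⟨fun x => ((dist x x₀ : ℝ) : ℂ) • v, ‖v‖₊, LipschitzWith.of_dist_le_mul fun x y => by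
    rw [dist_eq_norm, ← sub_smul, ← Complex.ofReal_sub, norm_smul, Complex.norm_real, mul_comm]
    exact mul_le_mul_of_nonneg_left (abs_dist_sub_le x y x₀) (norm_nonneg v)⟩

@[simp] theorem distSMul_apply (x₀ : X) (v : E) (x : X) :
    distSMul x₀ v x = ((dist x x₀ : ℝ) : ℂ) • v := rfl

theorem norm_sub_div_dist_le_lipConst (F : Lip X E) {x y : X} (h : x ≠ y) :
    ‖F x - F y‖ / dist x y ≤ F.lipConst :=
  le_ciSup F.bddAbove_quotient ⟨(x, y), h⟩

theorem norm_sub_le_lipConst_mul (F : Lip X E) (x y : X) :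
    ‖F x - F y‖ ≤ F.lipConst * dist x y := by
  rcases eq_or_ne x y with rfl | h
  · simp
  · exact (div_le_iff₀ (dist_pos.2 h)).1 (F.norm_sub_div_dist_le_lipConst h)

/-- The Lipschitz constant as a seminorm. -/
noncomputable def lipSeminorm (X E : Type*) [MetricSpace X] [NormedAddCommGroup E]
    [NormedSpace ℂ E] : Seminorm ℂ (Lip X E) :=
  Seminorm.of lipConst
    (fun F G => by
      refine Real.iSup_le (fun p => ?_) (add_nonneg F.lipConst_nonneg G.lipConst_nonneg)
      refine le_trans ?_ (add_le_add (F.norm_sub_div_dist_le_lipConst p.2)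
        (G.norm_sub_div_dist_le_lipConst p.2))
      rw [← add_div, add_apply, add_apply, add_sub_add_comm]
      exact div_le_div_of_nonneg_right (norm_add_le _ _) dist_nonneg)
    fun c F => by
      simp only [lipConst, smul_apply, ← smul_sub, norm_smul, mul_div_assoc,
        Real.mul_iSup_of_nonneg (norm_nonneg c)]

/-- A support functional of the Lipschitz constant at `G`. -/
theorem exists_lipConst_support (G : Lip X E) :
    ∃ ψ : Lip X E →ₗ[ℂ] ℂ, (∀ H, ‖ψ H‖ ≤ H.lipConst) ∧ ψ G = (G.lipConst : ℂ) :=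
  (lipSeminorm X E).exists_support G

/-- The map `F ↦ e(F x₀)` for a linear functional `e`. -/
def evalDual (e : E →ₗ[ℂ] ℂ) (x₀ : X) : Lip X E →ₗ[ℂ] ℂ where
  toFun F := e (F x₀)
  map_add' _ _ := e.map_add _ _
  map_smul' _ _ := e.map_smul _ _

@[simp] theorem evalDual_apply (e : E →ₗ[ℂ] ℂ) (x₀ : X) (F : Lip X E) :
    evalDual e x₀ F = e (F x₀) := rfl

variable [CompactSpace X]

theorem norm_apply_le_supNorm (F : Lip X E) (x : X) : ‖F x‖ ≤ F.supNorm :=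
  le_ciSup F.bddAbove_norm x

theorem norm_apply_le_norm (F : Lip X E) (x : X) : ‖F x‖ ≤ ‖F‖ :=
  (F.norm_apply_le_supNorm x).trans (le_add_of_nonneg_right F.lipConst_nonneg)


theorem norm_postcomp_le (A : E →L[ℂ] E) {C : ℝ} (hC : 0 ≤ C) (hA : ∀ e, ‖A e‖ ≤ C * ‖e‖)
    (F : Lip X E) : ‖postcomp A F‖ ≤ C * ‖F‖ := by
  rw [norm_def, norm_def, mul_add]
  refine add_le_add (Real.iSup_le (fun x => (hA _).trans ?_) ?_)
    (Real.iSup_le (fun p => ?_) ?_)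
  · exact mul_le_mul_of_nonneg_left (F.norm_apply_le_supNorm x) hC
  · exact mul_nonneg hC F.supNorm_nonneg
  · rw [postcomp_apply, postcomp_apply, ← map_sub]
    refine (div_le_div_of_nonneg_right (hA _) dist_nonneg).trans ?_
    rw [mul_div_assoc]
    exact mul_le_mul_of_nonneg_left (F.norm_sub_div_dist_le_lipConst p.2) hC
  · exact mul_nonneg hC F.lipConst_nonneg

theorem isHermitianOperator_postcomp {A : E →L[ℂ] E} (hA : IsHermitianOperator A) :
    IsHermitianOperator (postcomp A : Lip X E → Lip X E) := by
  refine .of_norm_add_smul_le (IsLinearMap.with_bound ⟨fun F G => ?_, fun c F => ?_⟩ ‖A‖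
    (norm_postcomp_le A (norm_nonneg A) A.le_opNorm)) (‖A‖ ^ 2) fun s F => ?_
  · ext x
    simp
  · ext x
    simp
  · exact norm_postcomp_le (ContinuousLinearMap.id ℂ E + ((s : ℂ) * Complex.I) • A)
      (by positivity) (hA.norm_add_smul_le s) F

/-! ### Testing hermitian operators on Lipschitz maps -/

theorem norm_evalDual_add_le {e : E →ₗ[ℂ] ℂ} (he : ∀ u, ‖e u‖ ≤ ‖u‖) (x₀ : X)
    {ψ : Lip X E →ₗ[ℂ] ℂ} (hψ : ∀ H, ‖ψ H‖ ≤ H.lipConst) (H : Lip X E) :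
    ‖(evalDual e x₀ + ψ) H‖ ≤ ‖H‖ :=
  (norm_add_le _ _).trans
    (add_le_add ((he _).trans (H.norm_apply_le_supNorm x₀)) (hψ H))

/-- At a constant map, any functional dominated by the Lipschitz constant may be added to a support
functional. Multiplying the difference quotient functional by `i` shows that it annihilates the
image of the constant map. -/
theorem apply_const_eq {T : Lip X E → Lip X E} (hT : IsHermitianOperator T) (u : E) (x y : X) :
    T (const X u) x = T (const X u) y := by
  by_contra hne
  have hxy : x ≠ y := fun h => hne (by rw [h])
  have hd : 0 < dist x y := dist_pos.2 hxy
  have : Nonempty X := ⟨x⟩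
  obtain ⟨e, he, heu⟩ := exists_support_functional u
  obtain ⟨g, hg, hgu⟩ := exists_support_functional (T (const X u) x - T (const X u) y)
  let ψ : Lip X E →ₗ[ℂ] ℂ :=
    (Complex.I * (((dist x y)⁻¹ : ℝ) : ℂ)) • (evalDual g x - evalDual g y)
  have hψ_apply : ∀ H : Lip X E,
      ψ H = Complex.I * (((dist x y)⁻¹ : ℝ) : ℂ) * g (H x - H y) := fun H => by
    simp [ψ]
  have hψ : ∀ H, ‖ψ H‖ ≤ H.lipConst := fun H => by
    rw [hψ_apply, norm_mul, norm_mul, Complex.norm_I, one_mul, Complex.norm_real,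
      Real.norm_of_nonneg (inv_nonneg.2 hd.le), inv_mul_eq_div]
    exact (div_le_div_of_nonneg_right (hg _) hd.le).trans (H.norm_sub_div_dist_le_lipConst hxy)
  have h0 : (e (T (const X u) x)).im = 0 := by
    refine hT.im_eq_zero (f := evalDual e x) (fun H => ?_) ?_
    · exact (he _).trans (H.norm_apply_le_norm x)
    · rw [norm_const, evalDual_apply, const_apply, heu]
  have h1 : ((evalDual e x + ψ) (T (const X u))).im = 0 := by
    refine hT.im_eq_zero (norm_evalDual_add_le he x hψ) ?_
    rw [norm_const, LinearMap.add_apply, hψ_apply]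
    simp [heu]
  rw [LinearMap.add_apply, Complex.add_im, evalDual_apply, h0, zero_add, hψ_apply, hgu, mul_assoc,
    ← Complex.ofReal_mul, Complex.I_mul_im, Complex.ofReal_re] at h1
  exact (mul_pos (inv_pos.2 hd) (norm_pos_iff.2 (sub_ne_zero.2 hne))).ne' h1

theorem isHermitianOperator_eval_const {T : Lip X E → Lip X E} (hT : IsHermitianOperator T)
    (x₀ : X) : IsHermitianOperator fun u => T (const X u) x₀ := by
  obtain ⟨hlin, C, hC, hbound⟩ := hT.1
  have : Nonempty X := ⟨x₀⟩
  refine .of_im_eq_zero (IsLinearMap.with_bound ⟨fun u v => ?_, fun c u => ?_⟩ C fun u => ?_)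
    fun e u he heu => ?_
  · rw [const_add, hlin.map_add, add_apply]
  · rw [const_smul, hlin.map_smul, smul_apply]
  · rw [← norm_const (X := X) u]
    exact ((T (const X u)).norm_apply_le_norm x₀).trans (hbound _)
  · refine hT.im_eq_zero (f := evalDual e x₀) (fun H => ?_) ?_
    · exact (he _).trans (H.norm_apply_le_norm x₀)
    · rw [norm_const, evalDual_apply, const_apply, heu]

/-- The real part of `ω` exceeds `1 / 2`, so moving from `lam * ω` by `t` in the direction `-1`
lowers the modulus by at least `t / 2`, once `lam` is large compared with `t`. -/
theorem norm_ofReal_mul_sub_le {ω : ℂ} (hω : ‖ω‖ = 1) (hre : 3 / 5 ≤ ω.re) {lam t : ℝ}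
    (ht : 0 ≤ t) (hlam : 15 * t ≤ 4 * lam) : ‖(lam : ℂ) * ω - t‖ ≤ lam - t / 2 := by
  refine abs_le_of_sq_le_sq' ?_ (by linarith) |>.2
  have h1 : ω.re ^ 2 + ω.im ^ 2 = 1 := by
    have := Complex.sq_norm ω
    rw [hω, Complex.normSq_apply] at this
    linarith
  rw [Complex.sq_norm, Complex.normSq_apply]
  simp only [Complex.sub_re, Complex.mul_re, Complex.ofReal_re, Complex.ofReal_im, Complex.sub_im,
    Complex.mul_im, zero_mul, sub_zero, add_zero]
  have h2 : lam * t * (3 / 5) ≤ lam * t * ω.re :=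
    mul_le_mul_of_nonneg_left hre (mul_nonneg (by linarith) ht)
  have h3 : t * (15 * t) ≤ t * (4 * lam) := mul_le_mul_of_nonneg_left hlam ht
  have h4 : (lam * ω.re - t) * (lam * ω.re - t) + lam * ω.im * (lam * ω.im)
      = lam ^ 2 * (ω.re ^ 2 + ω.im ^ 2) - 2 * (lam * t * ω.re) + t ^ 2 := by ring
  rw [h4, h1]
  nlinarith

/-- If `G` vanishes at `x₀` and falls off steeply in the direction `-v`, then adding a large
constant multiple of `ω v` yields a map whose norm is attained at `x₀`, for all `ω` in an arc around
`1`. The part `ψ` of the support functional that comes from the Lipschitz constant is the same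
for all `ω`. -/
theorem im_conj_mul_add_eq_zero {T : Lip X E → Lip X E} (hT : IsHermitianOperator T)
    (hconst : ∀ u, T (const X u) = 0) (F : Lip X E) (x₀ : X) (hF : F x₀ = 0) {v : E}
    (hv : ‖v‖ = 1) {e : E →ₗ[ℂ] ℂ} (he : ∀ u, ‖e u‖ ≤ ‖u‖) (hev : e v = 1) {M : ℝ}
    (hM : 2 * F.lipConst ≤ M) {ψ : Lip X E →ₗ[ℂ] ℂ} (hψ : ∀ H, ‖ψ H‖ ≤ H.lipConst)
    (hψG : ψ (F - (M : ℂ) • distSMul x₀ v) = ((F - (M : ℂ) • distSMul x₀ v).lipConst : ℂ))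
    {ω : ℂ} (hω : ‖ω‖ = 1) (hre : 3 / 5 ≤ ω.re) :
    (conj ω * e (T (F - (M : ℂ) • distSMul x₀ v) x₀)).im
      + (ψ (T (F - (M : ℂ) • distSMul x₀ v))).im = 0 := by
  set G := F - (M : ℂ) • distSMul x₀ v with hG
  have hM0 : 0 ≤ M := by linarith [F.lipConst_nonneg]
  have : Nonempty X := ⟨x₀⟩
  -- `lam` is large enough for `norm_ofReal_mul_sub_le` at every `t = M * dist x x₀`.
  set lam : ℝ := 15 / 4 * (M * Metric.diam (Set.univ : Set X)) with hlam
  have hlam0 : 0 ≤ lam := by positivity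
  have hωω : conj ω * ω = 1 := by
    rw [mul_comm, Complex.mul_conj, Complex.normSq_eq_norm_sq, hω]
    norm_num
  set W := G + const X (((lam : ℂ) * ω) • v) with hW
  have hW₀ : W x₀ = ((lam : ℂ) * ω) • v := by
    simp only [hW, hG, hF, add_apply, sub_apply, smul_apply, distSMul_apply, const_apply,
      dist_self, Complex.ofReal_zero, zero_smul, smul_zero, sub_zero, zero_add]
  have hsup : W.supNorm = lam := by
    refine le_antisymm (Real.iSup_le (fun x => ?_) hlam0) ?_
    · have hd : dist x x₀ ≤ Metric.diam (Set.univ : Set X) :=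
        Metric.dist_le_diam_of_mem isCompact_univ.isBounded (Set.mem_univ _) (Set.mem_univ _)
      have hx : W x = (F x - F x₀) + ((lam : ℂ) * ω - ((M * dist x x₀ : ℝ) : ℂ)) • v := by
        simp only [hW, hG, hF, add_apply, sub_apply, smul_apply, distSMul_apply, const_apply,
          sub_smul, smul_smul, Complex.ofReal_mul, sub_zero]
        abel
      rw [hx]
      refine (norm_add_le _ _).trans ?_
      rw [norm_smul, hv, mul_one]
      have h1 := F.norm_sub_le_lipConst_mul x x₀
      have h2 := norm_ofReal_mul_sub_le hω hre (t := M * dist x x₀) (lam := lam)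
        (by positivity) (by linarith [mul_le_mul_of_nonneg_left hd hM0])
      linarith [mul_le_mul_of_nonneg_right hM (dist_nonneg (x := x) (y := x₀))]
    · refine le_trans (le_of_eq ?_) (W.norm_apply_le_supNorm x₀)
      rw [hW₀, norm_smul, norm_mul, hω, hv, Complex.norm_real, Real.norm_of_nonneg hlam0]
      ring
  have hWnorm : ‖W‖ = lam + G.lipConst := by rw [norm_def, hsup, hW, lipConst_add_const]
  have hψ0 : ψ (const X (((lam : ℂ) * ω) • v)) = 0 :=
    norm_le_zero_iff.1 ((hψ _).trans_eq (lipConst_const _))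
  have hωe : ∀ u, ‖(conj ω • e) u‖ ≤ ‖u‖ := fun u => by
    rw [LinearMap.smul_apply, norm_smul, Complex.norm_conj, hω, one_mul]
    exact he u
  have key := hT.im_eq_zero (norm_evalDual_add_le hωe x₀ hψ) (v := W) (by
    rw [LinearMap.add_apply, evalDual_apply, hW₀, LinearMap.smul_apply, map_smul, hev, hW, map_add,
      hψ0, hψG, ← hW, hWnorm]
    push_cast
    simp only [smul_eq_mul]
    linear_combination (lam : ℂ) * hωω)
  have hTW : T W = T G := by
    rw [hW, hT.1.toIsLinearMap.map_add, hconst, add_zero]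
  rwa [hTW] at key

/-- `Im (conj ω * z) + c` is a trigonometric polynomial of degree one in the argument of `ω`. Having
the three zeros `1` and `(3 ± 4 i) / 5`, it vanishes identically. -/
theorem eq_zero_of_im_conj_mul {z : ℂ} {c : ℝ}
    (h : ∀ ω : ℂ, ‖ω‖ = 1 → 3 / 5 ≤ ω.re → (conj ω * z).im + c = 0) : z = 0 := by
  have hn : ∀ a : ℝ, a ^ 2 = (4 / 5) ^ 2 → ‖(⟨3 / 5, a⟩ : ℂ)‖ = 1 := fun a ha => by
    rw [← sq_eq_sq₀ (norm_nonneg _) zero_le_one, Complex.sq_norm, Complex.normSq_mk]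
    linarith
  have h1 := h 1 norm_one (by norm_num)
  have h2 := h ⟨3 / 5, 4 / 5⟩ (hn _ rfl) le_rfl
  have h3 := h ⟨3 / 5, -(4 / 5)⟩ (hn _ (by norm_num)) le_rfl
  simp only [map_one, one_mul, Complex.mul_im, Complex.conj_re, Complex.conj_im] at h1 h2 h3
  apply Complex.ext
  · rw [Complex.zero_re]
    linarith
  · rw [Complex.zero_im]
    linarith

/-- A hermitian operator that annihilates the constant maps vanishes. -/
theorem apply_eq_zero_of_const {T : Lip X E → Lip X E} (hT : IsHermitianOperator T)
    (hconst : ∀ u, T (const X u) = 0) (F : Lip X E) (x₀ : X) : T F x₀ = 0 := by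
  wlog hF : F x₀ = 0 generalizing F
  · have h := this (F - const X (F x₀)) (by simp)
    rwa [hT.1.toIsLinearMap.map_sub, hconst, sub_zero] at h
  by_contra hne
  have hn : ‖T F x₀‖ ≠ 0 := norm_ne_zero_iff.2 hne
  have hn' : (‖T F x₀‖ : ℂ) ≠ 0 := Complex.ofReal_ne_zero.2 hn
  obtain ⟨e, he, hev⟩ := exists_support_functional (T F x₀)
  set v : E := ((‖T F x₀‖ : ℂ)⁻¹) • T F x₀ with hv
  have hv1 : ‖v‖ = 1 := by
    rw [hv, norm_smul, norm_inv, Complex.norm_real, norm_norm, inv_mul_cancel₀ hn]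
  have hev1 : e v = 1 := by rw [hv, map_smul, hev, smul_eq_mul, inv_mul_cancel₀ hn']
  have key : ∀ M : ℝ, 2 * F.lipConst ≤ M →
      e (T F x₀) - M * e (T (distSMul x₀ v) x₀) = 0 := by
    intro M hM
    obtain ⟨ψ, hψ, hψG⟩ := exists_lipConst_support (F - (M : ℂ) • distSMul x₀ v)
    have h := eq_zero_of_im_conj_mul fun ω hω hre =>
      im_conj_mul_add_eq_zero hT hconst F x₀ hF hv1 he hev1 hM hψ hψG hω hre
    rwa [hT.1.toIsLinearMap.map_sub, hT.1.toIsLinearMap.map_smul, sub_apply, smul_apply, map_sub,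
      map_smul, smul_eq_mul] at h
  -- The expression in `key` is affine in `M`, hence its value at `M = 0` is zero as well.
  have h1 := key (2 * F.lipConst + 1) (by linarith)
  have h2 := key (2 * (2 * F.lipConst + 1)) (by linarith [F.lipConst_nonneg])
  push_cast at h1 h2
  refine hn' ?_
  rw [← hev]
  linear_combination 2 * h1 - h2

end Lip

theorem theorem2p3 {X : Type*} [MetricSpace X] [CompactSpace X]
    {E : Type*} [NormedAddCommGroup E] [NormedSpace ℂ E] [CompleteSpace E]
    (T : Lip X E → Lip X E) :
    IsHermitianOperator T ↔
      ∃ φ : E → E, IsHermitianOperator φ ∧ ∀ (F : Lip X E) (x : X), T F x = φ (F x) := by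
  constructor
  · intro hT
    rcases isEmpty_or_nonempty X with hX | ⟨⟨x₀⟩⟩
    · exact ⟨fun _ => 0, .of_im_eq_zero IsBoundedLinearMap.zero fun f _ _ _ => by simp,
        fun F x => isEmptyElim x⟩
    have hφ := Lip.isHermitianOperator_eval_const hT x₀
    refine ⟨_, hφ, fun F x => ?_⟩
    let A : E →L[ℂ] E := hφ.1.toContinuousLinearMap
    have hA : IsHermitianOperator A := hφ
    have h := Lip.apply_eq_zero_of_const (hT.sub (Lip.isHermitianOperator_postcomp hA))
      (fun u => ?_) F x
    · exact sub_eq_zero.1 h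
    · ext y
      exact sub_eq_zero.2 (Lip.apply_const_eq hT u y x₀)
  · rintro ⟨φ, hφ, hTφ⟩
    let A : E →L[ℂ] E := hφ.1.toContinuousLinearMap
    have hA : IsHermitianOperator A := hφ
    have hT : T = Lip.postcomp A := funext fun F => Lip.ext fun x => hTφ F x
    rw [hT]
    exact Lip.isHermitianOperator_postcomp hA
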